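/- An Orlicz function is a non-decreasing convex function $\Psi\colon[0,+\infty)\to[0,+\infty)$ with $\Psi(0)=0$ and $\lim_{x\to+\infty}\Psi(x)=+\infty$. For a finite measure $\mu$, $L^\Psi(\mu)$ is the space of (classes of) measurable functions $f$ with values in $\mathbb C$ such that $\int\Psi(|f|/C)\,d\mu<+\infty$ for some $C>0$, with norm $\|f\|_\Psi=\inf\{C>0:\int\Psi(|f|/C)\,d\mu\le1\}$, and the Morse–Transue space $M^\Psi(\mu)$ is the subspace of those $f\in L^\Psi(\mu)$ for which $\int\Psi(|f|/C)\,d\mu<+\infty$ for every $C>0$. Let $\mathbb D$ be the open unit disk of $\mathbb C$ with normalized area measure $\mathcal A$, and let $m$ be the normalized Lebesgue measure on $\mathbb T=\partial\mathbb D$. The Hardy–Orlicz space is $H^\Psi=\{f\in H^1: f^*\in L^\Psi(m)\}$, where $f^*(\xi)=\lim_{r\to1^-}f(r\xi)$ is the boundary values function of $f$, with norm $\|f\|_{H^\Psi}=\|f^*\|_{L^\Psi(m)}$. Let $J_\Psi$ be the canonical injection of $H^\Psi$ into the Bergman–Orlicz space of all analytic functions on $\mathbb D$ belonging to $L^\Psi(\mathbb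 D,\mathcal A)$, i.e. $J_\Psi f=f$, regarded as a measurable function on $(\mathbb D,\mathcal A)$. **Proposition.** For every Orlicz function $\Psi$, $J_\Psi$ is not order bounded into $M^\Psi(\mathbb D,\mathcal A)$. That is, there is no $g\in M^\Psi(\mathbb D,\mathcal A)$ with $g\ge0$ such that, for every $f\in H^\Psi$ with $\|f\|_{H^\Psi}\le1$, one has $|f(z)|\le g(z)$ for $\mathcal A$-almost every $z\in\mathbb D$. -/

import Mathlib

open MeasureTheory Filter Topology

noncomputable section

/-- An Orlicz function: a non-decreasing convex function on `[0, ∞)` with values in `[0, ∞)`,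
vanishing at `0` and tending to `∞` at `∞`.  (The values at negative reals play no role.) -/
structure OrliczFunction where
  toFun : ℝ → ℝ
  monotoneOn' : MonotoneOn toFun (Set.Ici 0)
  convexOn' : ConvexOn ℝ (Set.Ici 0) toFun
  map_zero' : toFun 0 = 0
  tendsto' : Tendsto toFun atTop atTop

namespace OrliczFunction

instance : CoeFun OrliczFunction (fun _ => ℝ → ℝ) := ⟨OrliczFunction.toFun⟩

variable {S : Type*} [MeasurableSpace S]

/-- The modular `∫ Ψ(|f| / C) dμ`, as an extended nonnegative number. -/
def modular (Ψ : OrliczFunction) (μ : Measure S) (f : S → ℂ) (C : ℝ) : ENNReal :=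
  ∫⁻ s, ENNReal.ofReal (Ψ (‖f s‖ / C)) ∂μ

/-- Membership in the Orlicz space `L^Ψ(μ)`. -/
def MemOrlicz (Ψ : OrliczFunction) (μ : Measure S) (f : S → ℂ) : Prop :=
  AEStronglyMeasurable f μ ∧ ∃ C : ℝ, 0 < C ∧ Ψ.modular μ f C < ⊤

/-- The Luxemburg norm of `L^Ψ(μ)`: the infimum of all `C > 0` with `∫ Ψ(|f| / C) dμ ≤ 1`. -/
def luxemburgNorm (Ψ : OrliczFunction) (μ : Measure S) (f : S → ℂ) : ℝ :=
  sInf {C : ℝ | 0 < C ∧ Ψ.modular μ f C ≤ 1}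

lemma nonneg (Ψ : OrliczFunction) {x : ℝ} (hx : 0 ≤ x) : 0 ≤ Ψ x := by
  have h := Ψ.monotoneOn' (Set.mem_Ici.2 le_rfl) (Set.mem_Ici.2 hx) hx
  rwa [Ψ.map_zero'] at h

lemma modular_congr (Ψ : OrliczFunction) {μ : Measure S} {f g : S → ℂ} (h : f =ᵐ[μ] g) (C : ℝ) :
    Ψ.modular μ f C = Ψ.modular μ g C :=
  lintegral_congr_ae (by filter_upwards [h] with s hs; simp [hs])

lemma modular_zero (Ψ : OrliczFunction) (μ : Measure S) (C : ℝ) : Ψ.modular μ 0 C = 0 := by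
  simp [modular, Ψ.map_zero']

lemma modular_smul_le (Ψ : OrliczFunction) (μ : Measure S) (c : ℂ) (f : S → ℂ) {C : ℝ}
    (hC : 0 < C) : Ψ.modular μ (c • f) ((‖c‖ + 1) * C) ≤ Ψ.modular μ f C := by
  refine lintegral_mono fun s => ENNReal.ofReal_le_ofReal ?_
  have hc : 0 < ‖c‖ + 1 := by positivity
  refine Ψ.monotoneOn' (Set.mem_Ici.2 (by positivity)) (Set.mem_Ici.2 (by positivity)) ?_
  rw [div_le_div_iff₀ (by positivity) hC]
  simp only [Pi.smul_apply, smul_eq_mul, norm_mul]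
  have : 0 ≤ ‖f s‖ * C := by positivity
  nlinarith

lemma convex_half (Ψ : OrliczFunction) {x y : ℝ} (hx : 0 ≤ x) (hy : 0 ≤ y) :
    Ψ ((x + y) / 2) ≤ Ψ x + Ψ y := by
  have h := Ψ.convexOn'.2 (Set.mem_Ici.2 hx) (Set.mem_Ici.2 hy)
    (by norm_num : (0 : ℝ) ≤ 1 / 2) (by norm_num : (0 : ℝ) ≤ 1 / 2) (by norm_num)
  simp only [smul_eq_mul] at h
  have e : (x + y) / 2 = 1 / 2 * x + 1 / 2 * y := by ring
  rw [e]
  linarith [Ψ.nonneg hx, Ψ.nonneg hy]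

lemma modular_mono_const (Ψ : OrliczFunction) (μ : Measure S) (f : S → ℂ) {C D : ℝ}
    (hC : 0 < C) (hCD : C ≤ D) : Ψ.modular μ f D ≤ Ψ.modular μ f C := by
  refine lintegral_mono fun s => ENNReal.ofReal_le_ofReal ?_
  have hD : 0 < D := hC.trans_le hCD
  exact Ψ.monotoneOn' (Set.mem_Ici.2 (by positivity)) (Set.mem_Ici.2 (by positivity))
    (div_le_div_of_nonneg_left (norm_nonneg _) hC hCD)

lemma measurable_comp (Ψ : OrliczFunction) {μ : Measure S} {f : S → ℂ}
    (hf : AEStronglyMeasurable f μ) {C : ℝ} (hC : 0 < C) :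
    AEMeasurable (fun s => ENNReal.ofReal (Ψ (‖f s‖ / C))) μ := by
  have hm : Monotone fun x : ℝ => Ψ (max x 0) := fun x y hxy =>
    Ψ.monotoneOn' (Set.mem_Ici.2 (le_max_right _ _)) (Set.mem_Ici.2 (le_max_right _ _))
      (max_le_max_right 0 hxy)
  have h := (hm.measurable.comp_aemeasurable (hf.norm.aemeasurable.div_const C)).ennreal_ofReal
  refine h.congr (Eventually.of_forall fun s => ?_)
  have : 0 ≤ ‖f s‖ / C := by positivity
  simp [max_eq_left this]

lemma modular_add_le (Ψ : OrliczFunction) {μ : Measure S} {f : S → ℂ} (g : S → ℂ)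
    (hf : AEStronglyMeasurable f μ) {C : ℝ} (hC : 0 < C) :
    Ψ.modular μ (f + g) (2 * C) ≤ Ψ.modular μ f C + Ψ.modular μ g C := by
  unfold modular
  rw [← lintegral_add_left' (Ψ.measurable_comp hf hC)]
  refine lintegral_mono fun s => ?_
  have h1 : 0 ≤ ‖f s‖ / C := by positivity
  have h2 : 0 ≤ ‖g s‖ / C := by positivity
  rw [← ENNReal.ofReal_add (Ψ.nonneg h1) (Ψ.nonneg h2)]
  refine ENNReal.ofReal_le_ofReal ((Ψ.monotoneOn' (Set.mem_Ici.2 (by positivity))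
    (Set.mem_Ici.2 (by positivity)) ?_).trans (Ψ.convex_half h1 h2))
  rw [← add_div, div_div, mul_comm C 2]
  exact div_le_div_of_nonneg_right (norm_add_le _ _) (by positivity)

lemma MemOrlicz.add {Ψ : OrliczFunction} {μ : Measure S} {f g : S → ℂ}
    (hf : Ψ.MemOrlicz μ f) (hg : Ψ.MemOrlicz μ g) : Ψ.MemOrlicz μ (f + g) := by
  obtain ⟨hfm, C, hC, hfC⟩ := hf
  obtain ⟨hgm, D, hD, hgD⟩ := hg
  have hM : 0 < max C D := lt_max_of_lt_left hC
  refine ⟨hfm.add hgm, 2 * max C D, by positivity,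
    (Ψ.modular_add_le g hfm hM).trans_lt (ENNReal.add_lt_top.2 ⟨?_, ?_⟩)⟩
  · exact (Ψ.modular_mono_const μ f hC (le_max_left _ _)).trans_lt hfC
  · exact (Ψ.modular_mono_const μ g hD (le_max_right _ _)).trans_lt hgD

lemma MemOrlicz.smul {Ψ : OrliczFunction} {μ : Measure S} {f : S → ℂ} (c : ℂ)
    (hf : Ψ.MemOrlicz μ f) : Ψ.MemOrlicz μ (c • f) := by
  obtain ⟨hfm, C, hC, hfC⟩ := hf
  exact ⟨hfm.const_smul c, (‖c‖ + 1) * C, by positivity,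
    (Ψ.modular_smul_le μ c f hC).trans_lt hfC⟩

lemma memOrlicz_zero (Ψ : OrliczFunction) (μ : Measure S) : Ψ.MemOrlicz μ 0 :=
  ⟨aestronglyMeasurable_zero, 1, one_pos, by simp [Ψ.modular_zero]⟩

lemma MemOrlicz.congr {Ψ : OrliczFunction} {μ : Measure S} {f g : S → ℂ}
    (hf : Ψ.MemOrlicz μ f) (h : f =ᵐ[μ] g) : Ψ.MemOrlicz μ g := by
  obtain ⟨hfm, C, hC, hfC⟩ := hf
  exact ⟨hfm.congr h, C, hC, by rwa [← Ψ.modular_congr h]⟩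

/-- The Orlicz space `L^Ψ(μ)`, as a space of classes of measurable functions. -/
def orliczSpace (Ψ : OrliczFunction) (μ : Measure S) : Submodule ℂ (S →ₘ[μ] ℂ) where
  carrier := {f | Ψ.MemOrlicz μ f}
  zero_mem' := (Ψ.memOrlicz_zero μ).congr AEEqFun.coeFn_zero.symm
  add_mem' {f g} hf hg := (MemOrlicz.add hf hg).congr (AEEqFun.coeFn_add f g).symm
  smul_mem' c f hf := (MemOrlicz.smul c hf).congr (AEEqFun.coeFn_smul c f).symm

/-- The Morse–Transue space `M^Ψ(μ)`: the `f ∈ L^Ψ(μ)` with `∫ Ψ(|f| / C) dμ < ∞` for all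
`C > 0`. -/
def morseTransue (Ψ : OrliczFunction) (μ : Measure S) : Submodule ℂ (S →ₘ[μ] ℂ) where
  carrier := {f | f ∈ Ψ.orliczSpace μ ∧ ∀ C : ℝ, 0 < C → Ψ.modular μ f C < ⊤}
  zero_mem' := ⟨Submodule.zero_mem _, fun C _ => by
    simp [Ψ.modular_congr (AEEqFun.coeFn_zero (μ := μ) (β := ℂ)) C, Ψ.modular_zero]⟩
  add_mem' {f g} hf hg := ⟨Submodule.add_mem _ hf.1 hg.1, fun C hC => by
    rw [Ψ.modular_congr (AEEqFun.coeFn_add f g) C]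
    have h := Ψ.modular_add_le g f.aestronglyMeasurable (half_pos hC)
    rw [mul_div_cancel₀ C two_ne_zero] at h
    exact h.trans_lt (ENNReal.add_lt_top.2 ⟨hf.2 _ (half_pos hC), hg.2 _ (half_pos hC)⟩)⟩
  smul_mem' c f hf := ⟨Submodule.smul_mem _ c hf.1, fun C hC => by
    rw [Ψ.modular_congr (AEEqFun.coeFn_smul c f) C]
    have hc : 0 < ‖c‖ + 1 := by positivity
    have h := Ψ.modular_smul_le μ c f (div_pos hC hc)
    rw [mul_div_cancel₀ C hc.ne'] at h
    exact h.trans_lt (hf.2 _ (div_pos hC hc))⟩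

end OrliczFunction

/-- The open unit disk `𝔻` of `ℂ`. -/
abbrev Disk : Type := Metric.ball (0 : ℂ) 1

/-- The unit circle `𝕋 = ∂𝔻`. -/
abbrev UnitCircle : Type := Metric.sphere (0 : ℂ) 1

/-- The point `e^{it}` of the unit circle. -/
def expI (t : ℝ) : UnitCircle :=
  ⟨Complex.exp (t * Complex.I), by simp [Complex.norm_exp_ofReal_mul_I]⟩

/-- The normalized area measure on the unit disk. -/
def areaDisk : Measure Disk :=
  (ENNReal.ofReal Real.pi)⁻¹ • (volume : Measure ℂ).comap Subtype.val

/-- The normalized Lebesgue measure on the unit circle: the image of `dt / 2π` on `(0, 2π]` under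
`t ↦ e^{it}`. -/
def circleMeasure : Measure UnitCircle :=
  (ENNReal.ofReal (2 * Real.pi))⁻¹ • (volume.restrict (Set.Ioc 0 (2 * Real.pi))).map expI

/-- Extension by zero of a function on the disk to `ℂ`. -/
def extendZero (f : Disk → ℂ) : ℂ → ℂ := Function.extend Subtype.val f 0

lemma extendZero_zero : extendZero 0 = 0 := by
  ext z
  by_cases h : z ∈ Set.range (Subtype.val : Disk → ℂ)
  · obtain ⟨w, rfl⟩ := h
    simp [extendZero]
  · simp [extendZero, Function.extend_apply' _ _ _ h]

lemma extendZero_add (f g : Disk → ℂ) : extendZero (f + g) = extendZero f + extendZero g := by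
  simpa [extendZero] using Function.extend_add (Subtype.val : Disk → ℂ) f g 0 0

lemma extendZero_smul (c : ℂ) (f : Disk → ℂ) : extendZero (c • f) = c • extendZero f := by
  simpa [extendZero] using Function.extend_smul c (Subtype.val : Disk → ℂ) f 0

/-- The Hardy space `H¹`: analytic functions `f` on the unit disk with
`sup_{0 ≤ r < 1} ∫ |f(rξ)| dm(ξ) < ∞`. -/
def hardyOne : Submodule ℂ (Disk → ℂ) where
  carrier := {f | DifferentiableOn ℂ (extendZero f) (Metric.ball 0 1) ∧
    ∃ K : NNReal, ∀ r : ℝ, 0 ≤ r → r < 1 →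
      ∫⁻ ξ : UnitCircle, ‖extendZero f (r * ξ)‖ₑ ∂circleMeasure ≤ K}
  zero_mem' := by
    refine ⟨?_, 0, fun r _ _ => ?_⟩ <;> simp [extendZero_zero, differentiableOn_zero]
  add_mem' {f g} := by
    rintro ⟨hf, K, hK⟩ ⟨hg, L, hL⟩
    refine ⟨by rw [extendZero_add]; exact hf.add hg, K + L, fun r h0 h1 => ?_⟩
    have hc : Continuous fun ξ : UnitCircle => extendZero f (r * ξ) := by
      refine hf.continuousOn.comp_continuous (by fun_prop) fun ξ => ?_
      have hξ : ‖(ξ : ℂ)‖ = 1 := by simp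
      simp [hξ, abs_of_nonneg h0, h1]
    rw [extendZero_add]
    calc ∫⁻ ξ : UnitCircle, ‖(extendZero f + extendZero g) (r * ξ)‖ₑ ∂circleMeasure
        ≤ ∫⁻ ξ : UnitCircle, (‖extendZero f (r * ξ)‖ₑ + ‖extendZero g (r * ξ)‖ₑ)
            ∂circleMeasure := lintegral_mono fun ξ => enorm_add_le _ _
      _ = _ := lintegral_add_left hc.measurable.enorm _
      _ ≤ _ := by push_cast; exact add_le_add (hK r h0 h1) (hL r h0 h1)
  smul_mem' c f := by
    rintro ⟨hf, K, hK⟩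
    refine ⟨by rw [extendZero_smul]; exact hf.const_smul c, ‖c‖₊ * K, fun r h0 h1 => ?_⟩
    simp only [extendZero_smul, Pi.smul_apply, enorm_smul]
    rw [lintegral_const_mul' _ _ enorm_ne_top]
    push_cast
    exact mul_le_mul_right (hK r h0 h1) _

lemma hardyOne_continuous {f : Disk → ℂ} (hf : f ∈ hardyOne) : Continuous f := by
  have h := hf.1.continuousOn.comp_continuous continuous_subtype_val (fun z : Disk => z.2)
  refine h.congr fun z => ?_
  exact Subtype.val_injective.extend_apply f 0 z

/-- The boundary values function `f*(ξ) = lim_{r → 1⁻} f(rξ)`. -/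
def boundaryValue (f : Disk → ℂ) (ξ : UnitCircle) : ℂ :=
  limUnder (𝓝[<] (1 : ℝ)) fun r : ℝ => extendZero f (r * ξ)

/-- `f` has a radial limit at almost every point of the circle.  By a theorem of Fatou this holds
for all `f ∈ H¹`. -/
def HasBoundaryValues (f : Disk → ℂ) : Prop :=
  ∀ᵐ ξ : UnitCircle ∂circleMeasure, Tendsto (fun r : ℝ => extendZero f (r * ξ)) (𝓝[<] (1 : ℝ))
    (𝓝 (boundaryValue f ξ))

lemma hasBoundaryValues_of {f : Disk → ℂ} {g : UnitCircle → ℂ}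
    (h : ∀ᵐ ξ : UnitCircle ∂circleMeasure,
      Tendsto (fun r : ℝ => extendZero f (r * ξ)) (𝓝[<] (1 : ℝ)) (𝓝 (g ξ))) :
    HasBoundaryValues f ∧ g =ᵐ[circleMeasure] boundaryValue f := by
  constructor
  · filter_upwards [h] with ξ hξ using tendsto_nhds_limUnder ⟨_, hξ⟩
  · filter_upwards [h] with ξ hξ using hξ.limUnder_eq.symm

/-- The Hardy–Orlicz space `H^Ψ = {f ∈ H¹ ; f* ∈ L^Ψ(m)}`. -/
def hardyOrlicz (Ψ : OrliczFunction) : Submodule ℂ (Disk → ℂ) where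
  carrier := {f | f ∈ hardyOne ∧ HasBoundaryValues f ∧
    Ψ.MemOrlicz circleMeasure (boundaryValue f)}
  zero_mem' := by
    obtain ⟨h1, h2⟩ := hasBoundaryValues_of (f := 0) (g := 0)
      (by simp [extendZero_zero])
    exact ⟨Submodule.zero_mem _, h1, (Ψ.memOrlicz_zero _).congr h2⟩
  add_mem' {f g} hf hg := by
    obtain ⟨h1, h2⟩ := hasBoundaryValues_of (f := f + g)
      (g := boundaryValue f + boundaryValue g) (by
        filter_upwards [hf.2.1, hg.2.1] with ξ hξ hξ'
        rw [extendZero_add]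
        exact hξ.add hξ')
    exact ⟨Submodule.add_mem _ hf.1 hg.1, h1, (hf.2.2.add hg.2.2).congr h2⟩
  smul_mem' c f hf := by
    obtain ⟨h1, h2⟩ := hasBoundaryValues_of (f := c • f) (g := c • boundaryValue f) (by
        filter_upwards [hf.2.1] with ξ hξ
        rw [extendZero_smul]
        exact hξ.const_smul c)
    exact ⟨Submodule.smul_mem _ c hf.1, h1, (hf.2.2.smul c).congr h2⟩

/-- The norm of `H^Ψ`: the Luxemburg norm of the boundary values function. -/
def hardyOrliczNorm (Ψ : OrliczFunction) (f : hardyOrlicz Ψ) : ℝ :=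
  Ψ.luxemburgNorm circleMeasure (boundaryValue f)

/-- The canonical injection `J_Ψ`, sending `f ∈ H^Ψ` to (the class of) `f` as a measurable function
on the disk with its area measure.  It is valued in the lattice of all classes of measurable
functions on the disk, which contains the Bergman–Orlicz space as well as `L^Ψ` and `M^Ψ`. -/
def canonicalInjection (Ψ : OrliczFunction) : hardyOrlicz Ψ →ₗ[ℂ] (Disk →ₘ[areaDisk] ℂ) where
  toFun f := AEEqFun.mk (f : Disk → ℂ) (hardyOne_continuous f.2.1).aestronglyMeasurable
  map_add' _ _ := rfl
  map_smul' _ _ := rfl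

/-- The operator `T`, defined on a space `X` with norm `nrm` and valued in classes of measurable
functions, is order bounded into `Y`: there is `y ∈ Y`, `y ≥ 0`, such that `|T x| ≤ y`
(almost everywhere) for every `x` in the unit ball of `X`. -/
def OrderBoundedInto {X S : Type*} [AddCommGroup X] [Module ℂ X] [MeasurableSpace S]
    {μ : Measure S} (nrm : X → ℝ) (T : X →ₗ[ℂ] (S →ₘ[μ] ℂ)) (Y : Submodule ℂ (S →ₘ[μ] ℂ)) :
    Prop :=
  ∃ y ∈ Y, (∀ᵐ s ∂μ, 0 ≤ (y s).re ∧ (y s).im = 0) ∧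
    ∀ x : X, nrm x ≤ 1 → ∀ᵐ s ∂μ, ‖T x s‖ ≤ (y s).re

end

/-! The unit ball of `H^Ψ` contains functions that peak near every boundary point, and together they
force any dominating function to be too large near the circle. For `A > 0` and `|a| < 1`, the
function `peak A a` is bounded by `A` on the closed disk, and its modulus on the circle is `A (1 -
|a|) / (1 + |a|)` times the Poisson kernel of `a`, which has mean one. Convexity gives `Ψ(tA) ≤
tΨ(A)` for `0 ≤ t ≤ 1`, so the modular of `peak A a` is at most one once `Ψ(A) (1 - |a|) ≤ 1`
(`modular_peak_le`). For `|z| ≥ r` and `a = r z / |z|`, the value at `z` has modulus at least `A /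
4` (`peak_ge`). Hence a dominating `g` satisfies `g ≥ A / 4` almost everywhere on `|z| ≥ r`, with `r
= 1 - 1/Ψ(A)` (`ae_le_of_dominates_unitBall`). On this annulus `Ψ(4g) ≥ Ψ(A)`, while its area is
comparable to `1/Ψ(A)`, so the integral of `Ψ(4g)` there is at least one. The area tends to zero as
`A → ∞`; if `g` were in `M^Ψ`, absolute continuity of the integral would make these integrals tend
to zero. -/

/-! ### Circle averages, the Poisson kernel and the area of an annulus. -/

theorem continuous_expI : Continuous expI := by
  unfold expI
  fun_prop

theorem lintegral_circleMeasure {h : UnitCircle → ENNReal} (hh : Measurable h) :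
    ∫⁻ ξ, h ξ ∂circleMeasure =
      (ENNReal.ofReal (2 * Real.pi))⁻¹ * ∫⁻ t in Set.Ioc 0 (2 * Real.pi), h (expI t) := by
  rw [circleMeasure, lintegral_smul_measure, lintegral_map hh continuous_expI.measurable,
    smul_eq_mul]

instance : IsProbabilityMeasure circleMeasure := by
  constructor
  have hpi : 0 < 2 * Real.pi := Real.two_pi_pos
  have h := lintegral_circleMeasure (h := fun _ => 1) measurable_const
  rw [lintegral_one] at h
  rw [h, setLIntegral_one, Real.volume_Ioc, sub_zero]
  exact ENNReal.inv_mul_cancel (by simpa using Real.pi_pos) ENNReal.ofReal_ne_top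

theorem lintegral_circleMeasure_ofReal {h : ℂ → ℝ} (hc : ContinuousOn h (Metric.sphere 0 1))
    (h0 : ∀ ξ ∈ Metric.sphere (0 : ℂ) 1, 0 ≤ h ξ) :
    ∫⁻ ξ : UnitCircle, ENNReal.ofReal (h ξ) ∂circleMeasure =
      ENNReal.ofReal (Real.circleAverage h 0 1) := by
  have hpi : 0 < 2 * Real.pi := Real.two_pi_pos
  have hcr : Continuous fun ξ : UnitCircle => h ξ := continuousOn_iff_continuous_domRestrict.1 hc
  have hct : Continuous fun t : ℝ => h (expI t) := hcr.comp continuous_expI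
  rw [lintegral_circleMeasure hcr.measurable.ennreal_ofReal, ← ofReal_integral_eq_lintegral_ofReal
    ((hct.integrableOn_Icc (a := 0) (b := 2 * Real.pi)).mono_set Set.Ioc_subset_Icc_self)
    (Eventually.of_forall fun t => h0 _ (expI t).2), ← ENNReal.ofReal_inv_of_pos hpi,
    ← ENNReal.ofReal_mul (by positivity), Real.circleAverage_def,
    intervalIntegral.integral_of_le hpi.le, smul_eq_mul]
  simp [expI, circleMap]

/-- This is the Poisson formula applied to the constant function 1. -/
theorem circleAverage_poissonKernel {a : ℂ} (ha : ‖a‖ < 1) :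
    Real.circleAverage (poissonKernel 0 a) 0 1 = 1 := by
  have h := DiffContOnCl.circleAverage_poissonKernel_smul (c := 0) (R := 1) (w := a)
    (f := fun _ : ℂ => (1 : ℂ)) diffContOnCl_const (by simpa using ha)
  have e : (poissonKernel 0 a • fun _ : ℂ => (1 : ℂ)) = fun z => (poissonKernel 0 a z : ℂ) := by
    ext z; simp
  rw [e, Real.circleAverage_def, intervalIntegral.integral_ofReal] at h
  rw [Real.circleAverage_def]
  apply Complex.ofReal_injective
  simpa using h

theorem lintegral_poissonKernel {a : ℂ} (ha : ‖a‖ < 1) :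
    ∫⁻ ξ : UnitCircle, ENNReal.ofReal (poissonKernel 0 a ξ) ∂circleMeasure = 1 := by
  rw [lintegral_circleMeasure_ofReal, circleAverage_poissonKernel ha, ENNReal.ofReal_one]
  · unfold poissonKernel
    refine ContinuousOn.div (by fun_prop) (by fun_prop) fun ξ hξ => ?_
    have hne : ξ ≠ a := by
      rintro rfl
      simp at hξ
      linarith
    simpa [sub_eq_zero] using hne
  · intro ξ hξ
    have hξ : ‖ξ‖ = 1 := by simpa using hξ
    rw [poissonKernel]
    refine div_nonneg ?_ (by positivity)
    simp only [sub_zero, hξ]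
    nlinarith [norm_nonneg a]

theorem areaDisk_le_norm {r : ℝ} (h0 : 0 ≤ r) (h1 : r ≤ 1) :
    areaDisk {z : Disk | r ≤ ‖(z : ℂ)‖} = ENNReal.ofReal (1 - r ^ 2) := by
  have hpi : 0 < Real.pi := Real.pi_pos
  have him : (Subtype.val '' {z : Disk | r ≤ ‖(z : ℂ)‖} : Set ℂ) =
      Metric.ball 0 1 \ Metric.ball 0 r := by
    ext z
    simp [and_comm]
  have hnn : (NNReal.pi : ENNReal) = ENNReal.ofReal Real.pi := by
    rw [← NNReal.coe_real_pi, ENNReal.ofReal_coe_nnreal]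
  rw [areaDisk, Measure.smul_apply, comap_subtype_coe_apply Metric.isOpen_ball.measurableSet, him,
    measure_sdiff (Metric.ball_subset_ball h1) Metric.isOpen_ball.nullMeasurableSet
      (by rw [Complex.volume_ball]; finiteness), Complex.volume_ball, Complex.volume_ball, hnn,
    ← ENNReal.ofReal_pow h0, ← ENNReal.ofReal_pow zero_le_one, ← ENNReal.ofReal_mul (by positivity),
    ← ENNReal.ofReal_mul (by positivity), ← ENNReal.ofReal_sub _ (by positivity),
    ← ENNReal.ofReal_inv_of_pos hpi, smul_eq_mul, ← ENNReal.ofReal_mul (by positivity)]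
  congr 1
  field_simp

/-! ### Size of the peak functions on the circle and inside the disk. -/

/-- The function `w ↦ A ((1 - |a|) / (1 - ā w))²`, which peaks near `a / |a|`. -/
noncomputable def peak (A : ℝ) (a w : ℂ) : ℂ :=
  A * ((1 - ‖a‖) / (1 - star a * w)) ^ 2

theorem one_sub_norm_le {a w : ℂ} (hw : ‖w‖ ≤ 1) : 1 - ‖a‖ ≤ ‖1 - star a * w‖ := by
  have h := norm_sub_norm_le (1 : ℂ) (star a * w)
  rw [norm_one, norm_mul, norm_star] at h
  nlinarith [norm_nonneg a]

theorem norm_peak {A : ℝ} (hA : 0 ≤ A) (a w : ℂ) :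
    ‖peak A a w‖ = A * ((1 - ‖a‖) ^ 2 / ‖1 - star a * w‖ ^ 2) := by
  have h : (1 - (‖a‖ : ℂ)) = ((1 - ‖a‖ : ℝ) : ℂ) := by push_cast; rfl
  rw [peak, h, norm_mul, norm_pow, norm_div, Complex.norm_real, Complex.norm_real, div_pow,
    Real.norm_of_nonneg hA, Real.norm_eq_abs, sq_abs]

theorem norm_peak_le {A : ℝ} (hA : 0 ≤ A) {a w : ℂ} (ha : ‖a‖ < 1) (hw : ‖w‖ ≤ 1) :
    ‖peak A a w‖ ≤ A := by
  have h := one_sub_norm_le (a := a) hw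
  rw [norm_peak hA]
  refine mul_le_of_le_one_right hA (div_le_one_of_le₀ ?_ (by positivity))
  have : 0 < 1 - ‖a‖ := by linarith
  gcongr

theorem one_sub_star_mul_ne_zero {a w : ℂ} (ha : ‖a‖ < 1) (hw : ‖w‖ ≤ 1) : 1 - star a * w ≠ 0 := by
  have h := one_sub_norm_le (a := a) hw
  rw [← norm_pos_iff]
  linarith

theorem differentiableAt_peak (A : ℝ) {a w : ℂ} (ha : ‖a‖ < 1) (hw : ‖w‖ ≤ 1) :
    DifferentiableAt ℂ (peak A a) w := by
  have h := one_sub_star_mul_ne_zero ha hw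
  unfold peak
  fun_prop (disch := assumption)

/-- Since `ξ̄ ξ = 1` on the circle, `|1 - ā ξ| = |ξ - a|`; the exponent 2 in `peak` then produces
the Poisson kernel `(1 - |a|²) / |ξ - a|²`. -/
theorem norm_peak_circle {A : ℝ} (hA : 0 ≤ A) {a ξ : ℂ} (ha : ‖a‖ < 1) (hξ : ‖ξ‖ = 1) :
    ‖peak A a ξ‖ = A * ((1 - ‖a‖) / (1 + ‖a‖)) * poissonKernel 0 a ξ := by
  have h : ‖1 - star a * ξ‖ = ‖ξ - a‖ := by
    have e : 1 - star a * ξ = star (ξ - a) * ξ := by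
      have : star ξ * ξ = 1 := by
        rw [Complex.star_def, ← Complex.normSq_eq_conj_mul_self, Complex.normSq_eq_norm_sq, hξ]
        simp
      rw [star_sub, sub_mul, this]
    rw [e, norm_mul, norm_star, hξ, mul_one]
  have hne : ‖ξ - a‖ ≠ 0 := by
    rw [← h]
    exact norm_ne_zero_iff.2 (one_sub_star_mul_ne_zero ha hξ.le)
  have : 1 + ‖a‖ ≠ 0 := by positivity
  rw [norm_peak hA, h, poissonKernel]
  simp only [sub_zero, hξ]
  field_simp
  ring

/-- With the centre on the ray through `z`, the denominator `1 - ā z` is the real number `1 - r|z|`.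
-/
theorem peak_ge {A : ℝ} (hA : 0 ≤ A) {r : ℝ} (h0 : 0 ≤ r) (h1 : r < 1) {z : ℂ} (hrz : r ≤ ‖z‖)
    (hz : ‖z‖ < 1) (hz0 : z ≠ 0) : A / 4 ≤ ‖peak A (r * (z / ‖z‖)) z‖ := by
  have hzn : (‖z‖ : ℂ) ≠ 0 := by simpa using hz0
  have ha : ‖(r : ℂ) * (z / ‖z‖)‖ = r := by
    rw [norm_mul, norm_div, Complex.norm_real, Complex.norm_real, norm_norm,
      div_self (norm_ne_zero_iff.2 hz0), mul_one, Real.norm_of_nonneg h0]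
  have e : 1 - star ((r : ℂ) * (z / ‖z‖)) * z = ((1 - r * ‖z‖ : ℝ) : ℂ) := by
    have : star z * z = (‖z‖ : ℂ) ^ 2 := by
      rw [Complex.star_def, ← Complex.normSq_eq_conj_mul_self, Complex.normSq_eq_norm_sq]
      simp
    simp only [star_mul', star_div₀, Complex.star_def, Complex.conj_ofReal] at this ⊢
    push_cast
    field_simp
    linear_combination (-(r : ℂ)) * this
  have hpos : 0 < 1 - r * ‖z‖ := by nlinarith
  rw [norm_peak hA, ha, e, Complex.norm_real, Real.norm_of_nonneg hpos.le, div_eq_mul_inv A]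
  refine mul_le_mul_of_nonneg_left ?_ hA
  rw [le_div_iff₀ (by positivity)]
  -- As `|z| ≥ r`, one has `1 - r|z| ≤ 1 - r² = (1 + r)(1 - r)`; squaring the factor 2 gives the
  -- constant 4.
  have h2 : 1 - r * ‖z‖ ≤ 2 * (1 - r) := by nlinarith
  nlinarith

/-! ### Functions differentiable at every point of the closed disk, as elements of `H^Ψ`. -/

theorem extendZero_apply {F : ℂ → ℂ} {w : ℂ} (hw : ‖w‖ < 1) :
    extendZero (fun z : Disk => F z) w = F w :=
  Subtype.val_injective.extend_apply (fun z : Disk => F z) 0 (⟨w, by simpa using hw⟩ : Disk)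

theorem norm_ofReal_mul_circle {r : ℝ} (h0 : 0 ≤ r) (ξ : UnitCircle) : ‖(r : ℂ) * ξ‖ = r := by
  have hξ : ‖(ξ : ℂ)‖ = 1 := by simp
  rw [norm_mul, hξ, mul_one, Complex.norm_real, Real.norm_of_nonneg h0]

section DiskAlgebra

variable {F : ℂ → ℂ} (hd : ∀ w, ‖w‖ ≤ 1 → DifferentiableAt ℂ F w)
include hd

theorem mem_hardyOne_of_bounded {A : NNReal} (hA : ∀ w, ‖w‖ ≤ 1 → ‖F w‖ ≤ A) :
    (fun z : Disk => F z) ∈ hardyOne := by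
  refine ⟨?_, A, fun r h0 h1 => ?_⟩
  · refine DifferentiableOn.congr (f := F)
      (fun w hw => (hd w (by simpa using (mem_ball_zero_iff.1 hw).le)).differentiableWithinAt)
      fun w hw => extendZero_apply (by simpa using hw)
  · calc ∫⁻ ξ : UnitCircle, ‖extendZero (fun z : Disk => F z) (r * ξ)‖ₑ ∂circleMeasure
        ≤ ∫⁻ _ : UnitCircle, (A : ENNReal) ∂circleMeasure := by
          refine lintegral_mono fun ξ => ?_
          have hn := norm_ofReal_mul_circle h0 ξ
          rw [extendZero_apply (hn.trans_lt h1)]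
          exact enorm_le_coe.2 (hA _ (hn.trans_lt h1).le)
      _ = A := by simp

theorem hasBoundaryValues_of_differentiableAt :
    HasBoundaryValues (fun z : Disk => F z) ∧
      (fun ξ : UnitCircle => F ξ) =ᵐ[circleMeasure] boundaryValue fun z : Disk => F z := by
  refine hasBoundaryValues_of (Eventually.of_forall fun ξ => ?_)
  have hξ : ‖(ξ : ℂ)‖ = 1 := by simp
  have hF : Tendsto (fun r : ℝ => F (r * ξ)) (𝓝 1) (𝓝 (F ξ)) := by
    have hr : ContinuousAt (fun r : ℝ => (r : ℂ) * ξ) 1 := by fun_prop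
    have := (hd ξ hξ.le).continuousAt
    refine Tendsto.comp (y := 𝓝 (ξ : ℂ)) this ?_
    simpa [ContinuousAt] using hr
  refine (hF.mono_left nhdsWithin_le_nhds).congr' ?_
  filter_upwards [Ioo_mem_nhdsLT (zero_lt_one : (0 : ℝ) < 1)] with r hr
  exact (extendZero_apply ((norm_ofReal_mul_circle hr.1.le ξ).trans_lt hr.2)).symm

theorem exists_mem_hardyOrlicz (Ψ : OrliczFunction) {A : NNReal}
    (hA : ∀ w, ‖w‖ ≤ 1 → ‖F w‖ ≤ A)
    (hΨ : Ψ.modular circleMeasure (fun ξ : UnitCircle => F ξ) 1 ≤ 1) :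
    ∃ f : hardyOrlicz Ψ, (f : Disk → ℂ) = (fun z : Disk => F z) ∧ hardyOrliczNorm Ψ f ≤ 1 := by
  obtain ⟨h1, h2⟩ := hasBoundaryValues_of_differentiableAt hd
  have hc : Continuous fun ξ : UnitCircle => F ξ := by
    refine continuous_iff_continuousAt.2 fun ξ => ?_
    exact ContinuousAt.comp (g := F) (hd ξ (by simp)).continuousAt
      continuous_subtype_val.continuousAt
  have hm : Ψ.MemOrlicz circleMeasure (fun ξ : UnitCircle => F ξ) :=
    ⟨hc.aestronglyMeasurable, 1, one_pos, hΨ.trans_lt ENNReal.one_lt_top⟩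
  refine ⟨⟨_, mem_hardyOne_of_bounded hd hA, h1, hm.congr h2⟩, rfl, ?_⟩
  refine csInf_le ⟨0, fun C hC => hC.1.le⟩ ⟨one_pos, ?_⟩
  rwa [← Ψ.modular_congr h2]

end DiskAlgebra

/-! ### Peak functions in the unit ball and the resulting lower bound. -/

theorem OrliczFunction.map_mul_le (Ψ : OrliczFunction) {A t : ℝ} (hA : 0 ≤ A) (h0 : 0 ≤ t)
    (h1 : t ≤ 1) : Ψ (t * A) ≤ t * Ψ A := by
  have h := Ψ.convexOn'.2 (Set.mem_Ici.2 hA) (Set.mem_Ici.2 le_rfl) h0 (sub_nonneg.2 h1)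
    (by ring)
  simpa [Ψ.map_zero'] using h

theorem modular_peak_le (Ψ : OrliczFunction) {A : ℝ} (hA : 0 < A) {a : ℂ} (ha : ‖a‖ < 1)
    (hΨ : Ψ A * (1 - ‖a‖) ≤ 1) :
    Ψ.modular circleMeasure (fun ξ : UnitCircle => peak A a ξ) 1 ≤ 1 := by
  -- Writing 1 as the integral of the Poisson kernel reduces the claim to a pointwise inequality.
  rw [← lintegral_poissonKernel ha, OrliczFunction.modular]
  refine lintegral_mono fun ξ => ENNReal.ofReal_le_ofReal ?_
  have hξ : ‖(ξ : ℂ)‖ = 1 := by simp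
  have hp := norm_peak_circle hA.le ha hξ
  have hle := norm_peak_le hA.le ha hξ.le
  have hP : 0 ≤ poissonKernel 0 a ξ := by
    rw [poissonKernel]
    refine div_nonneg ?_ (by positivity)
    simp only [sub_zero, hξ]
    nlinarith [norm_nonneg a]
  have h := Ψ.map_mul_le hA.le (t := ‖peak A a ξ‖ / A) (by positivity) (by rwa [div_le_one hA])
  rw [div_mul_cancel₀ _ hA.ne'] at h
  rw [div_one]
  refine h.trans ?_
  rw [hp, show A * ((1 - ‖a‖) / (1 + ‖a‖)) * poissonKernel 0 a ξ / A * Ψ A =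
    (Ψ A * (1 - ‖a‖)) / (1 + ‖a‖) * poissonKernel 0 a ξ by field_simp]
  refine mul_le_of_le_one_left hP (div_le_one_of_le₀ ?_ (by positivity))
  linarith [norm_nonneg a]

/-- If `g` dominates the unit ball of `H^Ψ`, then `g ≥ A / 4` where `|z| ≥ r`, provided that
`Ψ(A) (1 - r) ≤ 1`. -/
theorem ae_le_of_dominates_unitBall (Ψ : OrliczFunction) {g : Disk → ℝ}
    (hg : ∀ f : hardyOrlicz Ψ, hardyOrliczNorm Ψ f ≤ 1 →
      ∀ᵐ s ∂areaDisk, ‖canonicalInjection Ψ f s‖ ≤ g s)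
    {A r : ℝ} (hA : 0 < A) (h0 : 0 < r) (h1 : r < 1) (hΨ : Ψ A * (1 - r) ≤ 1) :
    ∀ᵐ z : Disk ∂areaDisk, r ≤ ‖(z : ℂ)‖ → A / 4 ≤ g z := by
  -- The exceptional null set depends on `ζ`, whereas the centre needed for the lower bound varies
  -- with `z`.
  have key : ∀ ζ : UnitCircle, ∀ᵐ z : Disk ∂areaDisk, ‖peak A (r * ζ) z‖ ≤ g z := by
    intro ζ
    have hn := norm_ofReal_mul_circle h0.le ζ
    have ha : ‖(r : ℂ) * ζ‖ < 1 := hn.trans_lt h1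
    obtain ⟨f, hf, hf1⟩ := exists_mem_hardyOrlicz (A := ⟨A, hA.le⟩)
      (fun w hw => differentiableAt_peak A ha hw) Ψ (fun w hw => norm_peak_le hA.le ha hw)
      (modular_peak_le Ψ hA ha (by rwa [hn]))
    filter_upwards [hg f hf1, AEEqFun.coeFn_mk (f : Disk → ℂ)
      (hardyOne_continuous f.2.1).aestronglyMeasurable (μ := areaDisk)] with z hz hz'
    have e : canonicalInjection Ψ f z = peak A (r * ζ) z := hz'.trans (congrFun hf z)
    rwa [e] at hz
  -- A countable dense set of directions gives a single null set; continuity in `ζ` then extends the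
  -- bound to every direction, including `z / |z|`.
  obtain ⟨D, hDc, hDd⟩ := TopologicalSpace.exists_countable_dense UnitCircle
  filter_upwards [(ae_ball_iff hDc).2 fun ζ _ => key ζ] with z hz hrz
  have hz1 : ‖(z : ℂ)‖ < 1 := mem_ball_zero_iff.1 z.2
  have hcont : Continuous fun ζ : UnitCircle => ‖peak A (r * ζ) z‖ := by
    unfold peak
    refine continuous_norm.comp (continuous_const.mul ((Continuous.div (by fun_prop) (by fun_prop)
      fun ζ => one_sub_star_mul_ne_zero ?_ hz1.le).pow 2))
    exact (norm_ofReal_mul_circle h0.le ζ).trans_lt h1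
  have hall : ∀ ζ : UnitCircle, ‖peak A (r * ζ) z‖ ≤ g z := fun ζ =>
    (isClosed_le hcont continuous_const).closure_subset_iff.2 hz (hDd ζ)
  have hz0 : (z : ℂ) ≠ 0 := norm_pos_iff.1 (h0.trans_le hrz)
  have hmem : (z : ℂ) / ‖(z : ℂ)‖ ∈ Metric.sphere (0 : ℂ) 1 := by
    rw [mem_sphere_zero_iff_norm, norm_div, Complex.norm_real, norm_norm,
      div_self (norm_ne_zero_iff.2 hz0)]
  exact (peak_ge hA.le h0.le h1 hrz hz1 hz0).trans (hall ⟨_, hmem⟩)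

/-! ### Contradiction with absolute continuity of the integral. -/

theorem mainTheorem11 (Ψ : OrliczFunction) :
    ¬ OrderBoundedInto (hardyOrliczNorm Ψ) (canonicalInjection Ψ) (Ψ.morseTransue areaDisk) := by
  rintro ⟨y, ⟨-, hy⟩, -, hdom⟩
  -- The scale `1 / 4` cancels the loss in the lower bound `A / 4`.
  have hfin := hy (1 / 4) (by norm_num)
  have hΨ : Tendsto (fun k : ℕ => Ψ k) atTop atTop := Ψ.tendsto'.comp tendsto_natCast_atTop_atTop
  -- The bound `2 ≤ Ψ k` keeps the radius `1 - 1/Ψ(k)` at least `1 / 2`, hence positive.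
  have hev : ∀ᶠ k : ℕ in atTop, 0 < k ∧ 2 ≤ Ψ k :=
    (eventually_gt_atTop 0).and (hΨ.eventually_ge_atTop 2)
  set E : ℕ → Set Disk := fun k => {z | 1 - (Ψ k)⁻¹ ≤ ‖(z : ℂ)‖} with hE
  have harea : ∀ᶠ k : ℕ in atTop,
      areaDisk (E k) = ENNReal.ofReal (1 - (1 - (Ψ k)⁻¹) ^ 2) := by
    filter_upwards [hev] with k hk
    have h2 : (Ψ k)⁻¹ ≤ 1 := inv_le_one_of_one_le₀ (by linarith)
    have h3 : 0 ≤ (Ψ k)⁻¹ := by have := hk.2; positivity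
    exact areaDisk_le_norm (by linarith) (by linarith)
  have hE0 : Tendsto (areaDisk ∘ E) atTop (𝓝 0) := by
    have h : Tendsto (fun k : ℕ => ENNReal.ofReal (1 - (1 - (Ψ k)⁻¹) ^ 2)) atTop (𝓝 0) := by
      have hi : Tendsto (fun k : ℕ => (Ψ k)⁻¹) atTop (𝓝 0) := tendsto_inv_atTop_zero.comp hΨ
      simpa using ENNReal.tendsto_ofReal (((hi.const_sub 1).pow 2).const_sub 1)
    exact h.congr' (harea.mono fun k hk => hk.symm)
  -- Membership in `M^Ψ` enters here: the modular at scale `1 / 4` is finite, so its integrals over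
  -- the shrinking annuli tend to zero.
  have hlim := tendsto_setLIntegral_zero (show Ψ.modular areaDisk y (1 / 4) ≠ ⊤ from hfin.ne) hE0
  obtain ⟨k, hlt, hk, har⟩ :=
    ((hlim.eventually_lt_const zero_lt_one).and (hev.and harea)).exists
  have hkpos : (0 : ℝ) < k := by exact_mod_cast hk.1
  have hpos : 0 < Ψ k := by linarith [hk.2]
  have hinv : (Ψ k)⁻¹ ≤ 1 / 2 := by
    rw [inv_le_comm₀ hpos (by norm_num)]
    linarith [hk.2]
  have hinv0 : 0 < (Ψ k)⁻¹ := by positivity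
  have hae := ae_le_of_dominates_unitBall Ψ (g := fun s => (y s).re) hdom hkpos
    (r := 1 - (Ψ k)⁻¹) (by linarith) (by linarith)
    (by rw [sub_sub_cancel, mul_inv_cancel₀ hpos.ne'])
  have hmeas : MeasurableSet (E k) :=
    measurableSet_le measurable_const (measurable_subtype_coe.norm)
  refine absurd hlt (not_lt.2 ?_)
  calc (1 : ENNReal) ≤ ENNReal.ofReal (Ψ k) * areaDisk (E k) := by
        -- The product equals `2 - 1/Ψ(k)`.
        rw [har, ← ENNReal.ofReal_mul hpos.le, ENNReal.one_le_ofReal]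
        have := mul_inv_cancel₀ hpos.ne'
        nlinarith
    _ = ∫⁻ _ in E k, ENNReal.ofReal (Ψ k) ∂areaDisk := (setLIntegral_const _ _).symm
    _ ≤ ∫⁻ s in E k, ENNReal.ofReal (Ψ (‖y s‖ / (1 / 4))) ∂areaDisk := by
        refine setLIntegral_mono_ae' hmeas ?_
        filter_upwards [hae] with s hs hsE
        refine ENNReal.ofReal_le_ofReal (Ψ.monotoneOn' (Set.mem_Ici.2 hkpos.le)
          (Set.mem_Ici.2 (by positivity)) ?_)
        have := (hs hsE).trans (Complex.re_le_norm _)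
        linarith
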